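/- Let $p$ be a prime and let $\Psi=(\psi_1,\dots,\psi_t)$ be a system of $t\ge 4$ linear forms $\psi_i:\mathbb{F}_p^D\to\mathbb{F}_p$; its image is the subspace $\{(\psi_1(x),\dots,\psi_t(x)) : x\in\mathbb{F}_p^D\}$ of $\mathbb{F}_p^t$. For nonempty $S\subseteq\{1,\dots,t\}$, let $\Psi(S)=(\psi_i)_{i\in S}$ be the corresponding subsystem, with image in $\mathbb{F}_p^S$. Let $s(\Psi)$ be the smallest size $|S|$ of a nonempty $S$ such that the image of $\Psi(S)$ contains no coordinate hyperplane $\{x\in\mathbb{F}_p^S : x_i=0\}$, $i\in S$. Each $\psi_i$ also induces, coordinatewise, a map $(\mathbb{F}_p^n)^D\to\mathbb{F}_p^n$, and for $f:\mathbb{F}_p^n\to\mathbb{R}$ one puts $$T_\Psi(f)=\frac1{p^{nD}}\sum_{x_1,\dots,x_D\in\mathbb{F}_p^n}\ \prod_{i=1}^t f(\psi_i(x_1,\dots,x_D)).$$ The system $\Psi$ is called Sidorenko if $T_\Psi(f)\ge\bigl(p^{-n}\sum_{x\in\mathbb{F}_p^n}f(x)\bigr)^t$ for all $n\ge1$ and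 all $f:\mathbb{F}_p^n\to[0,1]$. If the image of $\Psi$ has codimension $2$ in $\mathbb{F}_p^t$ and $s(\Psi)=t-1$, then $\Psi$ is not Sidorenko. In particular, no system of $5$ linear forms whose image has codimension $2$ and with $s(\Psi)=4$ is Sidorenko (Conjecture 5.1 of Kamčev, Liebenau and Morrison), and for odd $t\ge7$ there is no Sidorenko system of $t$ linear forms whose image has codimension $2$ and with $s(\Psi)=t-1$ (the answer to their Question 5.3 is no). -/

import Mathlib

open scoped BigOperators

/-- A system `Ψ = (ψ_i)_{i ∈ ι}` of linear forms `ψ_i : 𝔽_p^D → 𝔽_p`. A system of `t` linear forms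
is the case `ι = Fin t`. -/
abbrev LinearSystem (p D : ℕ) (ι : Type*) : Type _ :=
  ι → ((Fin D → ZMod p) →ₗ[ZMod p] ZMod p)

namespace LinearSystem

variable {p D : ℕ} {ι : Type*}

/-- The image of `Ψ : 𝔽_p^D → 𝔽_p^ι`. -/
def image (Ψ : LinearSystem p D ι) : Submodule (ZMod p) (ι → ZMod p) :=
  LinearMap.range (LinearMap.pi Ψ)

/-- The codimension of the image of `Ψ` in `𝔽_p^ι`. -/
noncomputable def codim (Ψ : LinearSystem p D ι) : ℕ :=
  Module.finrank (ZMod p) ((ι → ZMod p) ⧸ Ψ.image)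

/-- The subsystem `Ψ(S) = (ψ_i)_{i ∈ S}`. -/
def subsystem (Ψ : LinearSystem p D ι) (S : Finset ι) : LinearSystem p D S :=
  fun i => Ψ i

/-- The image of `Ψ` contains a coordinate hyperplane `{x ∈ 𝔽_p^ι : x_i = 0}`. -/
def ContainsCoordHyperplane (Ψ : LinearSystem p D ι) : Prop :=
  ∃ i : ι, ∀ x : ι → ZMod p, x i = 0 → x ∈ Ψ.image

/-- `s(Ψ)`: the size of the smallest (non-empty) subsystem of `Ψ` whose image does not contain a
coordinate hyperplane. A minimum over an empty set would be `0`; this does not occur if the image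
of `Ψ` has codimension two, as then `Ψ` itself is such a subsystem. -/
noncomputable def s (Ψ : LinearSystem p D ι) : ℕ :=
  sInf {k : ℕ | ∃ S : Finset ι, S.Nonempty ∧
    ¬ (Ψ.subsystem S).ContainsCoordHyperplane ∧ S.card = k}

/-- The map `(𝔽_p^n)^D → 𝔽_p^n` induced by the form `ψ_i`, acting coordinate by coordinate. -/
def lift (Ψ : LinearSystem p D ι) (n : ℕ) (i : ι) (x : Fin D → Fin n → ZMod p) :
    Fin n → ZMod p :=
  fun k => Ψ i (fun d => x d k)

/-- `T_Ψ(f) = 𝔼_{x_1, …, x_D ∈ 𝔽_p^n} ∏_i f (ψ_i (x_1, …, x_D))`. -/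
noncomputable def T [NeZero p] [Fintype ι] (Ψ : LinearSystem p D ι) {n : ℕ}
    (f : (Fin n → ZMod p) → ℝ) : ℝ :=
  𝔼 x : Fin D → Fin n → ZMod p, ∏ i : ι, f (Ψ.lift n i x)

/-- `Ψ` is Sidorenko: `T_Ψ(f) ≥ (𝔼 f)^t` for all `n ≥ 1` and all `f : 𝔽_p^n → [0,1]`, with `t` the
number of forms. -/
def IsSidorenko [NeZero p] [Fintype ι] (Ψ : LinearSystem p D ι) : Prop :=
  ∀ n : ℕ, 1 ≤ n → ∀ f : (Fin n → ZMod p) → ℝ, (∀ x, f x ∈ Set.Icc (0 : ℝ) 1) →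
    (𝔼 x : Fin n → ZMod p, f x) ^ Fintype.card ι ≤ Ψ.T f

end LinearSystem

/-! A zero form is refuted at once by the indicator of the nonzero vectors. Otherwise `s(Ψ) = t - 1`
says that every nonzero relation has at least `t - 1` nonzero entries. So the relations are the
vectors `a j * α + b j * β` with all minors `a i * b j - a j * b i` nonzero: the `(a j, b j)` are
`t` distinct points of the projective line. In Fourier space `T_Ψ` becomes a sum over pairs `z` of
products of coefficients at `a j • z.1 + b j • z.2`, and a nonzero `z` annihilates at most one of
these forms.

Take `f = (1 + g) / 2` with `g` of mean zero. Up to the factor `2⁻ᵗ`, `T_Ψ(f) - (𝔼 f)^t` is a sum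
over degenerate `z ≠ 0` (one form vanishes, `t - 1` coefficients remain) plus a generic sum with `t`
coefficients.

For even `t` (`not_isSidorenko_of_even`), all nonzero coefficients are `-ε`: the degenerate terms
are `-ε^(t-1)` and dominate for small `ε`.

For odd `t` (`not_isSidorenko_of_odd`), replacing `g` by `-g` flips the generic sum, so it suffices
that this sum exceeds the degenerate terms in absolute value. The coefficients of `g` are polynomial
phases: bilinearity gives near square-root cancellation in `g` (`norm_trigSum_symPhase_le`), while
Lagrange interpolation (`sum_prod_forms_mul_inv_minors_eq_zero`) makes the phases cancel along the
system. Averaging over auxiliary phases `y` isolates these coherent terms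
(`le_norm_sum_mul_sum_prod_symPhase`). -/

namespace LinearSystem

variable {p D : ℕ} {ι : Type*}

/-! ### Relations as a two-dimensional code of large minimum weight. -/

/-- The linear relations `w` satisfied by the forms of a system. -/
def relations [Fintype ι] (Ψ : LinearSystem p D ι) : Submodule (ZMod p) (ι → ZMod p) where
  carrier := {w | ∀ x, ∑ j, w j * Ψ j x = 0}
  add_mem' := by
    intro v w hv hw x
    simp only [Pi.add_apply, add_mul, Finset.sum_add_distrib, hv x, hw x, add_zero]
  zero_mem' := by intro x; simp
  smul_mem' := by
    intro c w hw x
    simp only [Pi.smul_apply, smul_eq_mul, mul_assoc, ← Finset.mul_sum, hw x, mul_zero]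

theorem mem_relations [Fintype ι] {Ψ : LinearSystem p D ι} {w : ι → ZMod p} :
    w ∈ Ψ.relations ↔ ∀ x, ∑ j, w j * Ψ j x = 0 := Iff.rfl

/-- Row rank equals column rank: the relations are the kernel of the transposed matrix of `Ψ`. -/
theorem finrank_relations [Fact p.Prime] [Fintype ι] [DecidableEq ι] (Ψ : LinearSystem p D ι) :
    Module.finrank (ZMod p) Ψ.relations = Ψ.codim := by
  set A : Matrix ι (Fin D) (ZMod p) := LinearMap.toMatrix' (LinearMap.pi Ψ) with hA
  have hAx : ∀ x, A.mulVec x = fun j => Ψ j x := by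
    intro x
    rw [hA, LinearMap.toMatrix'_mulVec]
    rfl
  have himg : Ψ.image = LinearMap.range A.mulVecLin := by
    rw [image, hA, ← Matrix.toLin'_apply', Matrix.toLin'_toMatrix']
  have hrel : Ψ.relations = LinearMap.ker A.transpose.mulVecLin := by
    ext w
    rw [LinearMap.mem_ker, Matrix.mulVecLin_apply, Matrix.mulVec_transpose, mem_relations]
    have key : ∀ x, ∑ j, w j * Ψ j x = Matrix.vecMul w A ⬝ᵥ x := by
      intro x
      rw [← Matrix.dotProduct_mulVec, hAx]
      rfl
    simp only [key]
    exact ⟨fun h => dotProduct_eq_zero _ h, fun h x => by simp [h]⟩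
  have h1 := LinearMap.finrank_range_add_finrank_ker A.transpose.mulVecLin
  have h2 := Submodule.finrank_quotient_add_finrank Ψ.image
  have h3 : Module.finrank (ZMod p) Ψ.image = A.rank := by rw [himg]; rfl
  have h4 : Module.finrank (ZMod p) (LinearMap.range A.transpose.mulVecLin) = A.rank :=
    A.rank_transpose
  rw [← hrel, h4] at h1
  rw [h3] at h2
  rw [codim]
  omega

/-- Each hyperplane `x i = 0` over the support contains a basis vector `e_j` with `j ≠ i`, and `e_j`
violates the relation because `w j ≠ 0`. On a support of size one the hyperplane is `{0}`, hence the
hypothesis `h2`. -/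
theorem s_le_card_support [Fintype ι] [DecidableEq ι] {Ψ : LinearSystem p D ι}
    {w : ι → ZMod p} (hw : w ∈ Ψ.relations)
    (h2 : 1 < (Finset.univ.filter fun j => w j ≠ 0).card) :
    Ψ.s ≤ (Finset.univ.filter fun j => w j ≠ 0).card := by
  set S := Finset.univ.filter fun j => w j ≠ 0 with hS
  refine Nat.sInf_le ⟨S, Finset.card_pos.mp (by omega), ?_, rfl⟩
  rintro ⟨i, hi⟩
  obtain ⟨j, hj, hji⟩ := Finset.exists_mem_ne h2 (i : ι)
  obtain ⟨x, hx⟩ := hi (Pi.single ⟨j, hj⟩ 1) (Pi.single_eq_of_ne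
    (fun h => hji (congrArg Subtype.val h).symm) _)
  have hx' : ∀ l : S, Ψ l x = (Pi.single ⟨j, hj⟩ 1 : S → ZMod p) l := fun l => congrFun hx l
  have h0 := hw x
  rw [← Finset.sum_subset (Finset.subset_univ S), ← Finset.sum_coe_sort,
    Finset.sum_eq_single (⟨j, hj⟩ : S)] at h0
  · rw [hx', Pi.single_eq_same, mul_one] at h0
    exact (Finset.mem_filter.mp hj).2 h0
  · intro l _ hl
    rw [hx', Pi.single_eq_of_ne hl, mul_zero]
  · intro h; exact absurd (Finset.mem_univ _) h
  · intro l _ hl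
    have : w l = 0 := by
      by_contra h
      exact hl (Finset.mem_filter.mpr ⟨Finset.mem_univ _, h⟩)
    rw [this, zero_mul]

theorem not_isSidorenko_of_eq_zero [Fact p.Prime] [Fintype ι] {Ψ : LinearSystem p D ι} {i : ι}
    (hi : Ψ i = 0) : ¬ Ψ.IsSidorenko := by
  intro h
  have h1 := h 1 le_rfl (fun x => if x = 0 then 0 else 1)
    (fun x => by split_ifs <;> simp)
  have hT : Ψ.T (fun x : Fin 1 → ZMod p => if x = 0 then (0 : ℝ) else 1) = 0 := by
    rw [T]
    refine Finset.expect_eq_zero fun x _ => Finset.prod_eq_zero (Finset.mem_univ i) ?_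
    rw [if_pos]
    funext k
    simp [lift, hi]
  rw [hT] at h1
  have hpos : (0 : ℝ) < 𝔼 x : Fin 1 → ZMod p, if x = 0 then (0 : ℝ) else 1 := by
    refine Finset.expect_pos' (fun x _ => by split_ifs <;> simp)
      ⟨1, Finset.mem_univ _, ?_⟩
    rw [if_neg one_ne_zero]
    exact one_pos
  exact absurd h1 (not_le.mpr (pow_pos hpos _))

/-- A system of nonzero forms of codimension two with `s(Ψ) = t - 1`: its relations are the
combinations of two vectors `a`, `b` whose `2 × 2` minors are all nonzero. -/
theorem exists_relations_eq [Fact p.Prime] {t : ℕ} (ht : 4 ≤ t)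
    {Ψ : LinearSystem p D (Fin t)} (hcodim : Ψ.codim = 2) (hs : Ψ.s = t - 1)
    (hne : ∀ i, Ψ i ≠ 0) :
    ∃ a b : Fin t → ZMod p,
      (∀ w, w ∈ Ψ.relations ↔ ∃ α β, w = fun j => a j * α + b j * β) ∧
      ∀ i j, i ≠ j → a i * b j - a j * b i ≠ 0 := by
  have hfr := Ψ.finrank_relations.trans hcodim
  let B := Module.finBasisOfFinrankEq (ZMod p) Ψ.relations hfr
  have hmem : ∀ w, w ∈ Ψ.relations ↔ ∃ α β : ZMod p,
      w = fun j => (B 0 : Fin t → ZMod p) j * α + (B 1 : Fin t → ZMod p) j * β := by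
    intro w
    constructor
    · intro hw
      refine ⟨B.repr ⟨w, hw⟩ 0, B.repr ⟨w, hw⟩ 1, ?_⟩
      have := congrArg Subtype.val (B.sum_repr ⟨w, hw⟩)
      rw [Fin.sum_univ_two] at this
      funext j
      refine (congrFun this j).symm.trans ?_
      simp [mul_comm]
    · rintro ⟨α, β, rfl⟩
      have := Ψ.relations.add_mem (Ψ.relations.smul_mem α (B 0).2) (Ψ.relations.smul_mem β (B 1).2)
      convert this using 1
      funext j
      simp [mul_comm]
  have hind : ∀ α β : ZMod p,
      (fun j => (B 0 : Fin t → ZMod p) j * α + (B 1 : Fin t → ZMod p) j * β) = 0 →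
      α = 0 ∧ β = 0 := by
    intro α β h
    have hz : α • B 0 + β • B 1 = 0 := by
      ext j
      have := congrFun h j
      simpa [mul_comm] using this
    have := Fintype.linearIndependent_iff.mp B.linearIndependent ![α, β]
      (by rw [Fin.sum_univ_two]; simpa using hz)
    exact ⟨this 0, this 1⟩
  -- A relation supported at one index would make that form zero, so the bound by `s` applies.
  have hweight : ∀ w ∈ Ψ.relations, w ≠ 0 →
      t - 1 ≤ (Finset.univ.filter fun j => w j ≠ 0).card := by
    intro w hw hw0
    rw [← hs]
    refine s_le_card_support hw ?_
    by_contra hcard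
    obtain ⟨i, hi⟩ := Function.ne_iff.mp hw0
    have huniq : ∀ j, j ≠ i → w j = 0 := by
      intro j hj
      by_contra h
      exact hj (Finset.card_le_one.mp (not_lt.mp hcard) j (by simp [h]) i (by simpa using hi))
    refine hne i (LinearMap.ext fun x => ?_)
    have h0 := hw x
    rw [Finset.sum_eq_single i (fun j _ hj => by rw [huniq j hj, zero_mul])
      (fun h => absurd (Finset.mem_univ _) h)] at h0
    exact (mul_eq_zero.mp h0).resolve_left hi
  refine ⟨fun j => (B 0 : Fin t → ZMod p) j, fun j => (B 1 : Fin t → ZMod p) j, hmem, ?_⟩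
  have hvan : ∀ i j, i ≠ j → ∀ α β : ZMod p,
      (B 0 : Fin t → ZMod p) i * α + (B 1 : Fin t → ZMod p) i * β = 0 →
      (B 0 : Fin t → ZMod p) j * α + (B 1 : Fin t → ZMod p) j * β = 0 → α = 0 ∧ β = 0 := by
    intro i j hij α β h1 h2
    refine hind α β ?_
    by_contra hne0
    have hle := hweight _ ((hmem _).mpr ⟨α, β, rfl⟩) hne0
    have hsub : (Finset.univ.filter fun l => (B 0 : Fin t → ZMod p) l * α +
        (B 1 : Fin t → ZMod p) l * β ≠ 0) ⊆ (Finset.univ.erase i).erase j := by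
      intro l hl
      have hl' := (Finset.mem_filter.mp hl).2
      rw [Finset.mem_erase, Finset.mem_erase]
      exact ⟨fun h => hl' (h ▸ h2), fun h => hl' (h ▸ h1), Finset.mem_univ _⟩
    have hc := Finset.card_le_card hsub
    rw [Finset.card_erase_of_mem (by simp [hij.symm]), Finset.card_erase_of_mem (by simp),
      Finset.card_univ, Fintype.card_fin] at hc
    omega
  intro i j hij hdet
  dsimp only at hdet
  -- If the minor vanished, both `(b i, -a i)` and `(b j, -a j)` would give relations vanishing at
  -- `i` and `j`. Hence `a` and `b` vanish at both indices, and then `(1, 0)` gives such a relation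
  -- too.
  obtain ⟨h1, h2⟩ := hvan i j hij ((B 1 : Fin t → ZMod p) i) (-(B 0 : Fin t → ZMod p) i)
    (by ring) (by linear_combination -hdet)
  have h3 := hvan i j hij ((B 1 : Fin t → ZMod p) j) (-(B 0 : Fin t → ZMod p) j)
    (by linear_combination hdet) (by ring)
  have := hvan i j hij 1 0 (by simpa using h2) (by simpa using h3.2)
  exact one_ne_zero this.1

/-! ### Fourier expansion of `T_Ψ`. -/

section Fourier

open ComplexConjugate

variable [Fact p.Prime] {κ : Type*} [Fintype κ] [DecidableEq κ]

/-- The function on `𝔽_p^κ` with Fourier coefficients `H`. -/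
noncomputable def trigSum (H : (κ → ZMod p) → ℂ) (x : κ → ZMod p) : ℂ :=
  ∑ r, H r * ZMod.stdAddChar (r ⬝ᵥ x)

theorem stdAddChar_sum {α : Type*} (s : Finset α) (f : α → ZMod p) :
    (ZMod.stdAddChar (∑ i ∈ s, f i) : ℂ) = ∏ i ∈ s, ZMod.stdAddChar (f i) := by
  classical
  induction s using Finset.induction_on with
  | empty => simp
  | insert i s hi ih => rw [Finset.sum_insert hi, Finset.prod_insert hi, AddChar.map_add_eq_mul, ih]

/-- Allows any nonempty finite coordinate set, in particular the block structure of `PhaseIndex`. -/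
theorem IsSidorenko.pow_expect_le [Fintype ι] {Ψ : LinearSystem p D ι} (hΨ : Ψ.IsSidorenko)
    [Nonempty κ] (f : (κ → ZMod p) → ℝ) (hf : ∀ x, f x ∈ Set.Icc (0 : ℝ) 1) :
    (𝔼 x, f x) ^ Fintype.card ι ≤
      𝔼 x : Fin D → κ → ZMod p, ∏ i, f (fun k => Ψ i (fun d => x d k)) := by
  let e := Fintype.equivFin κ
  have h := hΨ (Fintype.card κ) Fintype.card_pos (fun x => f (x ∘ e)) (fun x => hf _)
  rw [T] at h
  rw [Fintype.expect_equiv (e.arrowCongr (Equiv.refl (ZMod p))) f (fun x => f (x ∘ e)),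
    Fintype.expect_equiv ((Equiv.refl (Fin D)).arrowCongr (e.arrowCongr (Equiv.refl (ZMod p))))
      _ (fun x : Fin D → Fin (Fintype.card κ) → ZMod p =>
        ∏ i, f ((Ψ.lift (Fintype.card κ) i x) ∘ e))]
  · exact h
  · intro x
    refine Finset.prod_congr rfl fun i _ => congrArg f (funext fun k => ?_)
    simp [lift, Equiv.arrowCongr]
  · intro x
    refine congrArg f (funext fun k => ?_)
    simp [Equiv.arrowCongr]

theorem expect_stdAddChar_eq [Fintype ι] (Ψ : LinearSystem p D ι) (r : ι → κ → ZMod p)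
    [Decidable (∀ k, (fun j => r j k) ∈ Ψ.relations)] :
    𝔼 x : Fin D → κ → ZMod p,
      (ZMod.stdAddChar (∑ j, r j ⬝ᵥ fun k => Ψ j (fun d => x d k)) : ℂ) =
      if ∀ k, (fun j => r j k) ∈ Ψ.relations then 1 else 0 := by
  classical
  let φ : (Fin D → κ → ZMod p) →+ ZMod p :=
    { toFun := fun x => ∑ j, r j ⬝ᵥ fun k => Ψ j (fun d => x d k)
      map_zero' := by
        refine Finset.sum_eq_zero fun j _ => ?_
        have : (fun k : κ => Ψ j (fun d => (0 : Fin D → κ → ZMod p) d k)) = 0 :=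
          funext fun k => (Ψ j).map_zero
        rw [this, dotProduct_zero]
      map_add' := by
        intro x y
        rw [← Finset.sum_add_distrib]
        refine Finset.sum_congr rfl fun j _ => ?_
        rw [← dotProduct_add]
        congr 1
        funext k
        exact (Ψ j).map_add _ _ }
  have hφ : ∀ x, φ x = ∑ k, ∑ j, r j k * Ψ j (fun d => x d k) := fun x => Finset.sum_comm
  have h := AddChar.expect_eq_ite ((ZMod.stdAddChar : AddChar (ZMod p) ℂ).compAddMonoidHom φ)
  refine h.trans (if_congr ?_ rfl rfl)
  rw [AddChar.eq_zero_iff]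
  constructor
  · intro h0 k y
    have h1 := h0 (fun d k' => if k' = k then y d else 0)
    rw [AddChar.compAddMonoidHom_apply, ← (ZMod.stdAddChar (N := p)).map_zero_eq_one,
      ZMod.injective_stdAddChar.eq_iff, hφ, Finset.sum_eq_single k] at h1
    · simpa using h1
    · intro k' _ hk'
      refine Finset.sum_eq_zero fun j _ => ?_
      have : (fun d : Fin D => if k' = k then y d else 0) = 0 := by
        funext d; simp [hk']
      rw [this, map_zero, mul_zero]
    · intro hk; exact absurd (Finset.mem_univ _) hk
  · intro h0 x
    rw [AddChar.compAddMonoidHom_apply, hφ, Finset.sum_eq_zero fun k _ => h0 k _,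
      AddChar.map_zero_eq_one]

/-- By orthogonality only families of frequencies that are relations in each coordinate survive. The
pair `z` parametrizes them, injectively because one minor is nonzero. -/
theorem expect_prod_trigSum [Fintype ι] [DecidableEq ι] {Ψ : LinearSystem p D ι}
    {a b : ι → ZMod p}
    (hrel : ∀ w, w ∈ Ψ.relations ↔ ∃ α β, w = fun j => a j * α + b j * β)
    {i j : ι} (hij : a i * b j - a j * b i ≠ 0) (H : (κ → ZMod p) → ℂ) :
    𝔼 x : Fin D → κ → ZMod p, ∏ j, trigSum H (fun k => Ψ j (fun d => x d k)) =
      ∑ z : (κ → ZMod p) × (κ → ZMod p), ∏ j, H (a j • z.1 + b j • z.2) := by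
  classical
  have h1 : ∀ x : Fin D → κ → ZMod p, ∏ j, trigSum H (fun k => Ψ j (fun d => x d k)) =
      ∑ r : ι → κ → ZMod p, (∏ j, H (r j)) *
        ZMod.stdAddChar (∑ j, r j ⬝ᵥ fun k => Ψ j (fun d => x d k)) := by
    intro x
    simp only [trigSum]
    rw [Finset.prod_univ_sum, Fintype.piFinset_univ]
    refine Finset.sum_congr rfl fun r _ => ?_
    rw [Finset.prod_mul_distrib, stdAddChar_sum]
  rw [Finset.expect_congr rfl fun x _ => h1 x, Finset.expect_sum_comm]
  simp only [← Finset.mul_expect, expect_stdAddChar_eq, mul_ite, mul_one, mul_zero]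
  rw [← Finset.sum_filter]
  symm
  refine Finset.sum_nbij (fun z j => a j • z.1 + b j • z.2) ?_ ?_ ?_ (fun z _ => rfl)
  · intro z _
    refine Finset.mem_filter.mpr ⟨Finset.mem_univ _, fun k => (hrel _).mpr ⟨z.1 k, z.2 k, ?_⟩⟩
    funext j
    simp
  · rintro ⟨u, v⟩ _ ⟨u', v'⟩ _ h
    have key : ∀ k, u k = u' k ∧ v k = v' k := by
      intro k
      have hi : a i * u k + b i * v k = a i * u' k + b i * v' k := congrFun (congrFun h i) k
      have hj : a j * u k + b j * v k = a j * u' k + b j * v' k := congrFun (congrFun h j) k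
      constructor
      · refine mul_left_cancel₀ hij ?_
        linear_combination b j * hi - b i * hj
      · refine mul_left_cancel₀ hij ?_
        linear_combination a i * hj - a j * hi
    exact Prod.ext (funext fun k => (key k).1) (funext fun k => (key k).2)
  · intro r hr
    have hr' := (Finset.mem_filter.mp hr).2
    choose α β h using fun k => (hrel _).mp (hr' k)
    refine ⟨(α, β), Finset.mem_coe.mpr (Finset.mem_univ _), funext fun j => funext fun k => ?_⟩
    exact (congrFun (h k) j).symm

theorem expect_stdAddChar_dotProduct (r : κ → ZMod p) :
    𝔼 x : κ → ZMod p, (ZMod.stdAddChar (r ⬝ᵥ x) : ℂ) = if r = 0 then 1 else 0 := by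
  let φ : (κ → ZMod p) →+ ZMod p :=
    { toFun := fun x => r ⬝ᵥ x
      map_zero' := dotProduct_zero r
      map_add' := dotProduct_add r }
  have h := AddChar.expect_eq_ite ((ZMod.stdAddChar : AddChar (ZMod p) ℂ).compAddMonoidHom φ)
  refine h.trans (if_congr ?_ rfl rfl)
  rw [AddChar.eq_zero_iff]
  constructor
  · intro h0
    refine dotProduct_eq_zero r fun x => ?_
    have h1 := h0 x
    rwa [AddChar.compAddMonoidHom_apply, ← (ZMod.stdAddChar (N := p)).map_zero_eq_one,
      ZMod.injective_stdAddChar.eq_iff] at h1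
  · rintro rfl x
    rw [AddChar.compAddMonoidHom_apply]
    simp [φ]

theorem sum_stdAddChar_dotProduct (r : κ → ZMod p) :
    ∑ x : κ → ZMod p, (ZMod.stdAddChar (r ⬝ᵥ x) : ℂ) =
      if r = 0 then (p : ℂ) ^ Fintype.card κ else 0 := by
  rw [← Fintype.card_mul_expect, expect_stdAddChar_dotProduct, mul_ite, mul_one, mul_zero,
    Fintype.card_fun, ZMod.card, Nat.cast_pow]

theorem expect_trigSum (H : (κ → ZMod p) → ℂ) : 𝔼 x, trigSum H x = H 0 := by
  simp only [trigSum]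
  rw [Finset.expect_sum_comm]
  simp only [← Finset.mul_expect, expect_stdAddChar_dotProduct, mul_ite, mul_one, mul_zero]
  simp

theorem conj_trigSum {H : (κ → ZMod p) → ℂ} (hH : ∀ r, H (-r) = conj (H r))
    (x : κ → ZMod p) : conj (trigSum H x) = trigSum H x := by
  rw [trigSum, map_sum]
  refine Fintype.sum_equiv (Equiv.neg _) _ _ fun r => ?_
  rw [map_mul, ← hH, Equiv.neg_apply, neg_dotProduct, AddChar.map_neg_eq_conj]

/-- The Sidorenko property tested on `(1 + g) / 2`, where `g` is real-valued, bounded by `1`, and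
has Fourier coefficients `H` with `H 0 = 0`. -/
theorem IsSidorenko.one_le_re_sum_prod [Fintype ι] [DecidableEq ι] {Ψ : LinearSystem p D ι}
    (hΨ : Ψ.IsSidorenko) [Nonempty κ] {a b : ι → ZMod p}
    (hrel : ∀ w, w ∈ Ψ.relations ↔ ∃ α β, w = fun j => a j * α + b j * β)
    {i j : ι} (hij : a i * b j - a j * b i ≠ 0) {H : (κ → ZMod p) → ℂ}
    (hH : ∀ r, H (-r) = conj (H r)) (hH0 : H 0 = 0) (hbd : ∀ x, ‖trigSum H x‖ ≤ 1) :
    1 ≤ (∑ z : (κ → ZMod p) × (κ → ZMod p), ∏ j,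
      if a j • z.1 + b j • z.2 = 0 then 1 else H (a j • z.1 + b j • z.2)).re := by
  classical
  -- The Fourier coefficients of `1 + g`; the factor `2⁻¹ ^ t` will cancel against `(𝔼 f) ^ t`.
  set H' : (κ → ZMod p) → ℂ := fun r => if r = 0 then 1 else H r with hH'
  have htrig : ∀ x, trigSum H' x = 1 + trigSum H x := by
    intro x
    have : ∀ r, H' r * (ZMod.stdAddChar (r ⬝ᵥ x) : ℂ) =
        (if r = 0 then 1 else 0) + H r * ZMod.stdAddChar (r ⬝ᵥ x) := by
      intro r
      by_cases hr : r = 0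
      · subst hr; simp [hH', hH0]
      · simp [hH', hr]
    rw [trigSum, Finset.sum_congr rfl fun r _ => this r, Finset.sum_add_distrib,
      Finset.sum_ite_eq' Finset.univ, if_pos (Finset.mem_univ _), trigSum]
  have hreal : ∀ x, (((trigSum H x).re : ℝ) : ℂ) = trigSum H x := fun x =>
    Complex.conj_eq_iff_re.mp (conj_trigSum hH x)
  have hre : ∀ x, |(trigSum H x).re| ≤ 1 := fun x => (Complex.abs_re_le_norm _).trans (hbd x)
  set f : (κ → ZMod p) → ℝ := fun x => (1 + (trigSum H x).re) / 2 with hf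
  have hfC : ∀ x, ((f x : ℝ) : ℂ) = 2⁻¹ * trigSum H' x := by
    intro x
    rw [htrig, hf]
    push_cast
    rw [hreal]
    ring
  have hS := hΨ.pow_expect_le f fun x => by
    obtain ⟨h1, h2⟩ := abs_le.mp (hre x)
    constructor <;> simp only [hf] <;> linarith
  have hmean : 𝔼 x, f x = 2⁻¹ := by
    have : ((𝔼 x, f x : ℝ) : ℂ) = 2⁻¹ := by
      rw [Complex.ofReal_expect, Finset.expect_congr rfl fun x _ => hfC x, ← Finset.mul_expect,
        expect_trigSum]
      simp [hH']
    exact Complex.ofReal_injective (this.trans (by push_cast; rfl))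
  have hT : ((𝔼 x : Fin D → κ → ZMod p, ∏ i, f (fun k => Ψ i (fun d => x d k)) : ℝ) : ℂ) =
      2⁻¹ ^ Fintype.card ι * ∑ z : (κ → ZMod p) × (κ → ZMod p), ∏ j,
        H' (a j • z.1 + b j • z.2) := by
    rw [← expect_prod_trigSum hrel hij, Complex.ofReal_expect, Finset.mul_expect]
    refine Finset.expect_congr rfl fun x _ => ?_
    rw [Complex.ofReal_prod, Finset.prod_congr rfl fun i _ => hfC _, Finset.prod_mul_distrib,
      Finset.prod_const, Finset.card_univ]
  have hTre := congrArg Complex.re hT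
  rw [Complex.ofReal_re] at hTre
  rw [hmean, hTre] at hS
  have hcast : (2⁻¹ ^ Fintype.card ι : ℂ) = (((2⁻¹ : ℝ) ^ Fintype.card ι : ℝ) : ℂ) := by
    push_cast; rfl
  rw [hcast, Complex.re_ofReal_mul] at hS
  have hpos : (0 : ℝ) < 2⁻¹ ^ Fintype.card ι := by positivity
  exact le_of_mul_le_mul_left (by rwa [mul_one]) hpos

end Fourier

/-! ### Degenerate and generic terms; the case of even `t`. -/

section Perturbation

open ComplexConjugate

variable [Fact p.Prime] {κ : Type*}

theorem eq_zero_of_two_forms_eq_zero {a b : ι → ZMod p} {i j : ι}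
    (hij : a i * b j - a j * b i ≠ 0) {z : (κ → ZMod p) × (κ → ZMod p)}
    (hi : a i • z.1 + b i • z.2 = 0) (hj : a j • z.1 + b j • z.2 = 0) : z = 0 := by
  have key : ∀ k, z.1 k = 0 ∧ z.2 k = 0 := by
    intro k
    have hi' : a i * z.1 k + b i * z.2 k = 0 := congrFun hi k
    have hj' : a j * z.1 k + b j * z.2 k = 0 := congrFun hj k
    constructor
    · refine (mul_eq_zero.mp ?_).resolve_left hij
      linear_combination b j * hi' - b i * hj'
    · refine (mul_eq_zero.mp ?_).resolve_left hij
      linear_combination a i * hj' - a j * hi'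
  exact Prod.ext (funext fun k => (key k).1) (funext fun k => (key k).2)

variable [Fintype κ]

theorem prod_ite_eq_prod_erase [Fintype ι] [DecidableEq ι] {a b : ι → ZMod p}
    (hmin : ∀ i j, i ≠ j → a i * b j - a j * b i ≠ 0)
    {z : (κ → ZMod p) × (κ → ZMod p)} (hz : z ≠ 0) {i : ι} (hi : a i • z.1 + b i • z.2 = 0)
    (H : (κ → ZMod p) → ℂ) :
    (∏ j, if a j • z.1 + b j • z.2 = 0 then 1 else H (a j • z.1 + b j • z.2)) =
      ∏ j ∈ Finset.univ.erase i, H (a j • z.1 + b j • z.2) := by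
  rw [← Finset.mul_prod_erase _ _ (Finset.mem_univ i), if_pos hi, one_mul]
  refine Finset.prod_congr rfl fun j hj => if_neg fun h => hz ?_
  exact eq_zero_of_two_forms_eq_zero (hmin i j (Finset.ne_of_mem_erase hj).symm) hi h

variable [DecidableEq κ]

theorem not_isSidorenko_of_even [Fintype ι] [DecidableEq ι] {Ψ : LinearSystem p D ι}
    {a b : ι → ZMod p}
    (hrel : ∀ w, w ∈ Ψ.relations ↔ ∃ α β, w = fun j => a j * α + b j * β)
    (hmin : ∀ i j, i ≠ j → a i * b j - a j * b i ≠ 0) {i j : ι} (hij : i ≠ j)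
    (heven : Even (Fintype.card ι)) : ¬ Ψ.IsSidorenko := by
  intro hΨ
  have hp : (0 : ℝ) < p := Nat.cast_pos.mpr (Fact.out : p.Prime).pos
  set N : ℝ := (p : ℝ) with hN
  -- With this `ε`, the `p ^ 2` error terms `ε ^ t` add up to `ε ^ (t - 1) / 2`, half of one
  -- degenerate term.
  set ε : ℝ := 1 / (2 * N ^ 2) with hε
  have hε0 : 0 < ε := by positivity
  have hp1 : 1 ≤ N := Nat.one_le_cast.mpr (Fact.out : p.Prime).one_le
  set H : (Unit → ZMod p) → ℂ := fun r => if r = 0 then 0 else ((-ε : ℝ) : ℂ) with hH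
  have hHle : ∀ r, ‖H r‖ ≤ ε := by
    intro r
    by_cases hr : r = 0
    · simp [hH, hr, hε0.le]
    · rw [hH]; dsimp only; rw [if_neg hr, Complex.norm_real, norm_neg, Real.norm_of_nonneg hε0.le]
  have hcard : (Fintype.card (Unit → ZMod p) : ℝ) = N := by simp [hN, ZMod.card]
  have hbd : ∀ x, ‖trigSum H x‖ ≤ 1 := by
    intro x
    refine (norm_sum_le _ _).trans ?_
    refine (Finset.sum_le_card_nsmul _ _ ε fun r _ => ?_).trans ?_
    · rw [norm_mul, AddChar.norm_apply, mul_one]; exact hHle r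
    · rw [Finset.card_univ, nsmul_eq_mul, hcard, hε, mul_one_div, div_le_one (by positivity)]
      nlinarith
  have hmain := hΨ.one_le_re_sum_prod hrel (hmin i j hij) (H := H)
    (fun r => by simp [hH, apply_ite conj]) (by simp [hH]) hbd
  rw [Complex.re_sum] at hmain
  -- A nonzero point annihilated by the form `i`. All degenerate terms are negative, so keeping this
  -- one suffices.
  set z₀ : (Unit → ZMod p) × (Unit → ZMod p) := (fun _ => b i, fun _ => -a i) with hz₀
  have hz₀0 : z₀ ≠ 0 := by
    intro h
    have h1 : b i = 0 := congrFun (congrArg Prod.fst h) ()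
    have h2 : -a i = 0 := congrFun (congrArg Prod.snd h) ()
    refine hmin i j hij ?_
    rw [h1, neg_eq_zero.mp h2]; ring
  have hz₀i : a i • z₀.1 + b i • z₀.2 = 0 := by
    funext k
    simp [hz₀]
    ring
  have hcard1 : ∀ l : ι, (Finset.univ.erase l).card = Fintype.card ι - 1 := fun l => by
    rw [Finset.card_erase_of_mem (Finset.mem_univ l), Finset.card_univ]
  have hpos : 0 < Fintype.card ι := Fintype.card_pos_iff.mpr ⟨i⟩
  have hodd : Odd (Fintype.card ι - 1) := Nat.Even.sub_odd hpos heven odd_one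
  have herase : ∀ z : (Unit → ZMod p) × (Unit → ZMod p), z ≠ 0 → ∀ l, a l • z.1 + b l • z.2 = 0 →
      (∏ j, if a j • z.1 + b j • z.2 = 0 then 1 else H (a j • z.1 + b j • z.2)) =
        ((-ε ^ (Fintype.card ι - 1) : ℝ) : ℂ) := by
    intro z hz l hl
    rw [prod_ite_eq_prod_erase hmin hz hl, Finset.prod_congr rfl (g := fun _ => ((-ε : ℝ) : ℂ)),
      Finset.prod_const, hcard1, ← Complex.ofReal_pow, hodd.neg_pow]
    intro m hm
    refine if_neg fun h => hz ?_
    exact eq_zero_of_two_forms_eq_zero (hmin l m (Finset.ne_of_mem_erase hm).symm) hl h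
  have hterm : ∀ z : (Unit → ZMod p) × (Unit → ZMod p),
      (∏ j, if a j • z.1 + b j • z.2 = 0 then 1 else H (a j • z.1 + b j • z.2)).re ≤
        (if z = 0 then 1 else 0) + (if z = z₀ then -ε ^ (Fintype.card ι - 1) else 0) +
          ε ^ Fintype.card ι := by
    intro z
    have hεt : 0 < ε ^ Fintype.card ι := by positivity
    have hεt' : 0 < ε ^ (Fintype.card ι - 1) := by positivity
    by_cases hz : z = 0
    · subst hz
      rw [if_pos rfl, if_neg hz₀0.symm]
      simp [hεt.le]
    · rw [if_neg hz]
      by_cases hl : ∃ l, a l • z.1 + b l • z.2 = 0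
      · obtain ⟨l, hl⟩ := hl
        rw [herase z hz l hl, Complex.ofReal_re]
        split_ifs <;> linarith
      · have hzz : z ≠ z₀ := fun h => hl ⟨i, h ▸ hz₀i⟩
        rw [if_neg hzz, zero_add, zero_add]
        refine (Complex.re_le_norm _).trans ?_
        rw [norm_prod]
        refine (Finset.prod_le_prod (fun _ _ => norm_nonneg _) (g := fun _ => ε) ?_).trans ?_
        · intro m _
          rw [if_neg fun h => hl ⟨m, h⟩]
          exact hHle _
        · rw [Finset.prod_const, Finset.card_univ]
  have hsum := hmain.trans (Finset.sum_le_sum fun z _ => hterm z)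
  rw [Finset.sum_add_distrib, Finset.sum_add_distrib, Finset.sum_ite_eq' Finset.univ,
    Finset.sum_ite_eq' Finset.univ, if_pos (Finset.mem_univ _), if_pos (Finset.mem_univ _),
    Finset.sum_const, Finset.card_univ, Fintype.card_prod, nsmul_eq_mul, Nat.cast_mul, hcard]
    at hsum
  have hεN : ε * N ^ 2 = 1 / 2 := by rw [hε]; field_simp
  have hpow : ε ^ Fintype.card ι = ε ^ (Fintype.card ι - 1) * ε := by
    rw [← pow_succ, Nat.sub_add_cancel hpos]
  have hεt' : 0 < ε ^ (Fintype.card ι - 1) := by positivity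
  rw [hpow] at hsum
  have : N * N * (ε ^ (Fintype.card ι - 1) * ε) = ε ^ (Fintype.card ι - 1) * (ε * N ^ 2) := by ring
  rw [this, hεN] at hsum
  linarith

/-- For coefficients `H` of size at most `ε`, the products over all the forms are bounded by the
contribution of the points where some form vanishes. -/
theorem IsSidorenko.neg_le_re_sum_prod [Fintype ι] [DecidableEq ι] {Ψ : LinearSystem p D ι}
    (hΨ : Ψ.IsSidorenko) [Nonempty κ] {a b : ι → ZMod p}
    (hrel : ∀ w, w ∈ Ψ.relations ↔ ∃ α β, w = fun j => a j * α + b j * β)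
    (hmin : ∀ i j, i ≠ j → a i * b j - a j * b i ≠ 0) {i j : ι} (hij : i ≠ j)
    {H : (κ → ZMod p) → ℂ} (hH : ∀ r, H (-r) = conj (H r)) (hH0 : H 0 = 0)
    (hbd : ∀ x, ‖trigSum H x‖ ≤ 1) {ε : ℝ} (hHε : ∀ r, ‖H r‖ ≤ ε) :
    -(Fintype.card ι * (Fintype.card (κ → ZMod p) * ε ^ (Fintype.card ι - 1))) ≤
      (∑ z : (κ → ZMod p) × (κ → ZMod p), ∏ j, H (a j • z.1 + b j • z.2)).re := by
  have hε0 : 0 ≤ ε := (norm_nonneg _).trans (hHε 0)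
  have hmain := hΨ.one_le_re_sum_prod hrel (hmin i j hij) hH hH0 hbd
  have hterm : ∀ z : (κ → ZMod p) × (κ → ZMod p),
      (∏ j, if a j • z.1 + b j • z.2 = 0 then 1 else H (a j • z.1 + b j • z.2)).re ≤
        (if z = 0 then 1 else 0) +
          (∑ l, if a l • z.1 + b l • z.2 = 0 then ε ^ (Fintype.card ι - 1) else 0) +
          (∏ j, H (a j • z.1 + b j • z.2)).re := by
    intro z
    by_cases hl : ∃ l, a l • z.1 + b l • z.2 = 0
    · obtain ⟨l, hl⟩ := hl
      -- Since `H 0 = 0`, the full product vanishes at degenerate points and may be summed over all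
      -- `z`.
      rw [Finset.prod_eq_zero (f := fun j => H (a j • z.1 + b j • z.2)) (Finset.mem_univ l)
        (by rw [hl, hH0]), Complex.zero_re, add_zero]
      by_cases hz : z = 0
      · subst hz
        have : 0 ≤ ∑ l : ι, if a l • (0 : (κ → ZMod p) × (κ → ZMod p)).1 +
            b l • (0 : (κ → ZMod p) × (κ → ZMod p)).2 = 0 then ε ^ (Fintype.card ι - 1) else 0 :=
          Finset.sum_nonneg fun l _ => by split_ifs <;> positivity
        rw [if_pos rfl]
        simpa using this
      · rw [if_neg hz, zero_add, prod_ite_eq_prod_erase hmin hz hl]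
        refine ((Complex.re_le_norm _).trans ?_).trans
          (Finset.single_le_sum (f := fun l => if a l • z.1 + b l • z.2 = 0 then
            ε ^ (Fintype.card ι - 1) else 0) (fun m _ => by split_ifs <;> positivity)
            (Finset.mem_univ l))
        rw [if_pos hl, norm_prod]
        refine (Finset.prod_le_prod (fun _ _ => norm_nonneg _) (g := fun _ => ε)
          fun m _ => hHε _).trans ?_
        rw [Finset.prod_const, Finset.card_erase_of_mem (Finset.mem_univ l), Finset.card_univ]
    · have hz : z ≠ 0 := by
        rintro rfl
        exact hl ⟨i, by simp⟩
      rw [if_neg hz, Finset.prod_congr rfl fun m _ => if_neg fun h => hl ⟨m, h⟩]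
      have : 0 ≤ ∑ l, if a l • z.1 + b l • z.2 = 0 then ε ^ (Fintype.card ι - 1) else 0 :=
        Finset.sum_nonneg fun l _ => by split_ifs <;> positivity
      linarith
  have hcount : ∀ l, (∑ z : (κ → ZMod p) × (κ → ZMod p),
      if a l • z.1 + b l • z.2 = 0 then ε ^ (Fintype.card ι - 1) else 0) ≤
        Fintype.card (κ → ZMod p) * ε ^ (Fintype.card ι - 1) := by
    intro l
    obtain ⟨m, hm⟩ : ∃ m, m ≠ l := by
      by_cases h : i = l
      · exact ⟨j, fun h' => hij (h.trans h'.symm)⟩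
      · exact ⟨i, h⟩
    rw [← Finset.sum_filter, Finset.sum_const, nsmul_eq_mul]
    refine mul_le_mul_of_nonneg_right (Nat.cast_le.mpr ?_) (by positivity)
    rw [← Finset.card_univ (α := κ → ZMod p)]
    -- On the zero set of the form `l`, any other form `m` is injective.
    refine Finset.card_le_card_of_injOn (fun z => a m • z.1 + b m • z.2)
      (fun _ _ => Finset.mem_coe.mpr (Finset.mem_univ _)) ?_
    intro z hz w hw hzw
    have hz' := (Finset.mem_filter.mp hz).2
    have hw' := (Finset.mem_filter.mp hw).2
    refine sub_eq_zero.mp (eq_zero_of_two_forms_eq_zero (hmin l m hm.symm) ?_ ?_)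
    · rw [Prod.fst_sub, Prod.snd_sub, smul_sub, smul_sub, sub_add_sub_comm, hz', hw', sub_zero]
    · dsimp only at hzw
      rw [Prod.fst_sub, Prod.snd_sub, smul_sub, smul_sub, sub_add_sub_comm, hzw, sub_self]
  rw [Complex.re_sum] at hmain
  have hsum := hmain.trans (Finset.sum_le_sum fun z _ => hterm z)
  rw [Finset.sum_add_distrib, Finset.sum_add_distrib, Finset.sum_ite_eq' Finset.univ,
    if_pos (Finset.mem_univ _), Finset.sum_comm, ← Complex.re_sum] at hsum
  have h2 := Finset.sum_le_sum fun l (_ : l ∈ (Finset.univ : Finset ι)) => hcount l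
  rw [Finset.sum_const, Finset.card_univ, nsmul_eq_mul] at h2
  linarith

end Perturbation

/-! ### Interpolation identities on the projective line. -/

section Interpolation

variable {K : Type*} [Field K] [DecidableEq ι]

/-- Lagrange interpolation on the projective line: a product of `|S| - 2` linear forms in two
variables, summed over the points `(a j, b j)` with the weights `∏_{i ≠ j} [i, j]⁻¹`, vanishes. -/
theorem sum_prod_forms_mul_inv_minors_eq_zero (a b : ι → K)
    (hmin : ∀ i j, i ≠ j → a i * b j - a j * b i ≠ 0) (L : List (K × K)) (S : Finset ι)
    (hS : S.card = L.length + 2) :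
    ∑ j ∈ S, (L.map fun ℓ => ℓ.1 * a j + ℓ.2 * b j).prod *
      ∏ i ∈ S.erase j, (a i * b j - a j * b i)⁻¹ = 0 := by
  induction L generalizing S with
  | nil =>
    obtain ⟨i, j, hij, rfl⟩ := Finset.card_eq_two.mp hS
    have h1 : ({i, j} : Finset ι).erase i = {j} := by
      rw [Finset.erase_insert (by simpa using hij)]
    have h2 : ({i, j} : Finset ι).erase j = {i} := by
      rw [Finset.pair_comm, Finset.erase_insert (by simpa using hij.symm)]
    rw [Finset.sum_pair hij, h1, h2]
    simp only [List.map_nil, List.prod_nil, one_mul, Finset.prod_singleton]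
    rw [← neg_sub (a i * b j), inv_neg, neg_add_cancel]
  | cons ℓ L ih =>
    obtain ⟨i, hi, j, hj, hij⟩ := Finset.one_lt_card.mp (show 1 < S.card by omega)
    -- The induction hypothesis on `S.erase i`: the new factor cancels one inverse minor and removes
    -- the term `c = i`.
    have key : ∀ i ∈ S, ∑ c ∈ S, (a i * b c - a c * b i) *
        ((L.map fun ℓ => ℓ.1 * a c + ℓ.2 * b c).prod *
          ∏ k ∈ S.erase c, (a k * b c - a c * b k)⁻¹) = 0 := by
      intro i hi
      rw [← Finset.add_sum_erase S _ hi, sub_self, zero_mul, zero_add,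
        ← ih (S.erase i) (by rw [Finset.card_erase_of_mem hi, hS, List.length_cons]; omega)]
      refine Finset.sum_congr rfl fun c hc => ?_
      have hci := Finset.ne_of_mem_erase hc
      rw [← Finset.mul_prod_erase (S.erase c) _ (Finset.mem_erase.mpr ⟨hci.symm, hi⟩),
        Finset.erase_right_comm]
      have := hmin i c hci.symm
      field_simp
    refine (mul_eq_zero.mp ?_).resolve_left (hmin i j hij)
    -- The Plücker identity `[i, j] ℓ(c) = ℓ(j) [i, c] - ℓ(i) [j, c]`, where `[i, j] = a i * b j - a
    -- j * b i`, expresses the extra factor `ℓ(c)` through two instances of `key`.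
    have h := congrArg₂ (fun s t => (ℓ.1 * a j + ℓ.2 * b j) * s - (ℓ.1 * a i + ℓ.2 * b i) * t)
      (key i hi) (key j hj)
    simp only [mul_zero, sub_zero] at h
    rw [← h, Finset.mul_sum, Finset.mul_sum, Finset.mul_sum, ← Finset.sum_sub_distrib]
    refine Finset.sum_congr rfl fun c _ => ?_
    rw [List.map_cons, List.prod_cons]
    ring

variable [Fintype ι]

/-- The weight `∏_{i ≠ j} [i, j]⁻¹` of the `j`-th point. -/
def nodalWeight (a b : ι → K) (j : ι) : K :=
  ∏ i ∈ Finset.univ.erase j, (a i * b j - a j * b i)⁻¹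

theorem nodalWeight_ne_zero {a b : ι → K} (hmin : ∀ i j, i ≠ j → a i * b j - a j * b i ≠ 0)
    (j : ι) : nodalWeight a b j ≠ 0 :=
  Finset.prod_ne_zero_iff.mpr fun i hi => inv_ne_zero (hmin i j (Finset.ne_of_mem_erase hi))

theorem sum_nodalWeight_mul_eq_zero {a b : ι → K}
    (hmin : ∀ i j, i ≠ j → a i * b j - a j * b i ≠ 0) {q : ℕ} (hq : Fintype.card ι = q + 3)
    (x y x' y' : K) :
    ∑ j, nodalWeight a b j * ((a j * x + b j * y) ^ q * (a j * x' + b j * y')) = 0 := by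
  have h := sum_prod_forms_mul_inv_minors_eq_zero a b hmin
    ((x', y') :: List.replicate q (x, y)) Finset.univ
    (by rw [Finset.card_univ, hq, List.length_cons, List.length_replicate])
  rw [← h]
  refine Finset.sum_congr rfl fun j _ => ?_
  rw [List.map_cons, List.prod_cons, List.map_replicate, List.prod_replicate, nodalWeight]
  ring

/-- A linear change of coordinates multiplies every minor by its determinant, and each weight
contains `t - 1` inverse minors. -/
theorem nodalWeight_perm {a b : ι → K} {σ : ι → ι} (hσ : Function.Bijective σ) {x y x' y' : K}
    (ha : ∀ j, a j * x + b j * y = a (σ j)) (hb : ∀ j, a j * x' + b j * y' = b (σ j)) (j : ι) :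
    nodalWeight a b (σ j) =
      (x * y' - y * x')⁻¹ ^ (Fintype.card ι - 1) * nodalWeight a b j := by
  have hcard : (Finset.univ.erase j).card = Fintype.card ι - 1 := by
    rw [Finset.card_erase_of_mem (Finset.mem_univ j), Finset.card_univ]
  rw [nodalWeight, nodalWeight, ← hcard, ← Finset.prod_const, ← Finset.prod_mul_distrib]
  symm
  refine Finset.prod_nbij σ ?_ hσ.1.injOn ?_ ?_
  · intro i hi
    exact Finset.mem_erase.mpr ⟨hσ.1.ne (Finset.ne_of_mem_erase hi), Finset.mem_univ _⟩
  · intro k hk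
    obtain ⟨i, rfl⟩ := hσ.2 k
    refine ⟨i, ?_, rfl⟩
    simp only [Finset.coe_erase, Finset.coe_univ, Set.mem_sdiff, Set.mem_univ, true_and,
      Set.mem_singleton_iff] at hk ⊢
    exact fun h => hk (h ▸ rfl)
  · intro i _
    rw [← mul_inv, ← ha, ← ha, ← hb, ← hb]
    congr 1
    ring

/-- The points are distinct on the projective line; the quotient of minors is an affine coordinate
away from the point `i`. -/
theorem card_le_card_field_add_one [Fintype K] {a b : ι → K}
    (hmin : ∀ i j, i ≠ j → a i * b j - a j * b i ≠ 0) {i k : ι} (hik : i ≠ k) :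
    Fintype.card ι ≤ Fintype.card K + 1 := by
  have h : (Finset.univ.erase i).card ≤ (Finset.univ : Finset K).card := by
    refine Finset.card_le_card_of_injOn
      (fun j => (a k * b j - a j * b k) / (a i * b j - a j * b i))
      (fun _ _ => Finset.mem_coe.mpr (Finset.mem_univ _)) ?_
    intro j hj l hl hjl
    have hj' := hmin i j (Finset.ne_of_mem_erase hj).symm
    have hl' := hmin i l (Finset.ne_of_mem_erase hl).symm
    dsimp only at hjl
    rw [div_eq_div_iff hj' hl'] at hjl
    by_contra hne
    refine hmin j l hne ((mul_eq_zero.mp ?_).resolve_left (hmin i k hik))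
    linear_combination -hjl
  rw [Finset.card_erase_of_mem (Finset.mem_univ i), Finset.card_univ, Finset.card_univ] at h
  omega

end Interpolation

/-! ### Polynomial phases: cancellation in the function, coherence along the system. -/

section Phase

open ComplexConjugate

/-- The coordinates used by the polynomial phases: two label coordinates and two blocks of `m`. -/
abbrev PhaseIndex (m : ℕ) : Type := Fin 2 ⊕ (Fin m ⊕ Fin m)

variable {m : ℕ}

/-- The phase polynomial `∑_k y_k ^ q * z_k`. -/
def phasePoly (q : ℕ) (r : PhaseIndex m → ZMod p) : ZMod p :=
  ∑ k, r (Sum.inr (Sum.inl k)) ^ q * r (Sum.inr (Sum.inr k))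

/-- The label coordinates of `r` are those of the `l`-th point `(a l, b l)`. -/
def HasLabel (a b : ι → ZMod p) (l : ι) (r : PhaseIndex m → ZMod p) : Prop :=
  (fun i => r (Sum.inl i)) = ![a l, b l]

instance (a b : ι → ZMod p) (l : ι) (r : PhaseIndex m → ZMod p) : Decidable (HasLabel a b l r) :=
  inferInstanceAs (Decidable ((fun i => r (Sum.inl i)) = ![a l, b l]))

theorem hasLabel_iff {a b : ι → ZMod p} {l : ι} {r : PhaseIndex m → ZMod p} :
    HasLabel a b l r ↔ r (Sum.inl 0) = a l ∧ r (Sum.inl 1) = b l := by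
  rw [HasLabel, funext_iff, Fin.forall_fin_two]
  simp

variable [Fact p.Prime]

theorem sum_phaseIndex {M : Type*} [AddCommMonoid M] (F : (PhaseIndex m → ZMod p) → M) :
    ∑ r, F r = ∑ ρ : Fin 2 → ZMod p, ∑ Y : Fin m → ZMod p, ∑ Z : Fin m → ZMod p,
      F (Sum.elim ρ (Sum.elim Y Z)) := by
  have h : ∀ {α β : Type} [Fintype α] [Fintype β] [DecidableEq α] [DecidableEq β]
      (G : (α ⊕ β → ZMod p) → M), ∑ r, G r = ∑ f : α → ZMod p, ∑ g : β → ZMod p,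
        G (Sum.elim f g) := by
    intro α β _ _ _ _ G
    rw [← Fintype.sum_prod_type' (f := fun f g => G (Sum.elim f g))]
    refine Fintype.sum_equiv (Equiv.sumArrowEquivProdArrow α β (ZMod p)) _ _ fun r => ?_
    congr 1
    funext x
    cases x <;> rfl
  rw [h]
  exact Finset.sum_congr rfl fun ρ _ => h _

theorem card_pow_mul_add_eq_zero_le {q : ℕ} (hq : 0 < q) {w : ZMod p} (hw : w ≠ 0)
    (c : Fin m → ZMod p) :
    (Finset.univ.filter fun Y : Fin m → ZMod p => ∀ k, w * Y k ^ q + c k = 0).card ≤ q ^ m := by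
  classical
  have hsub : (Finset.univ.filter fun Y : Fin m → ZMod p => ∀ k, w * Y k ^ q + c k = 0) ⊆
      Fintype.piFinset fun k => (Polynomial.nthRoots q (-c k / w)).toFinset := by
    intro Y hY
    rw [Fintype.mem_piFinset]
    intro k
    have := (Finset.mem_filter.mp hY).2 k
    rw [Multiset.mem_toFinset, Polynomial.mem_nthRoots hq, eq_div_iff hw]
    linear_combination this
  refine (Finset.card_le_card hsub).trans ?_
  rw [Fintype.card_piFinset]
  refine (Finset.prod_le_pow_card _ _ q fun k _ => ?_).trans ?_
  · exact (Multiset.toFinset_card_le _).trans (Polynomial.card_nthRoots q _)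
  · rw [Finset.card_univ, Fintype.card_fin]

variable [Fintype ι]

/-- The phase `e (y l + w l * P r)` on the points with label `l`, and `0` without a label. -/
noncomputable def labelledPhase (a b w : ι → ZMod p) (q : ℕ) (y : ι → ZMod p)
    (r : PhaseIndex m → ZMod p) : ℂ :=
  ∑ l, if HasLabel a b l r then ZMod.stdAddChar (y l + w l * phasePoly q r) else 0

/-- The sign attached to a Boolean. -/
def boolSign (s : Bool) : ZMod p := if s then 1 else -1

/-- The Hermitian symmetrization of `labelledPhase`. -/
noncomputable def symPhase (a b w : ι → ZMod p) (q : ℕ) (y : ι → ZMod p)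
    (r : PhaseIndex m → ZMod p) : ℂ :=
  labelledPhase a b w q y r + conj (labelledPhase a b w q y (-r))

theorem symPhase_neg (a b w : ι → ZMod p) (q : ℕ) (y : ι → ZMod p) (r : PhaseIndex m → ZMod p) :
    symPhase a b w q y (-r) = conj (symPhase a b w q y r) := by
  rw [symPhase, symPhase, neg_neg, map_add, Complex.conj_conj, add_comm]

theorem norm_labelledPhase_le (a b w : ι → ZMod p) (q : ℕ) (y : ι → ZMod p)
    (r : PhaseIndex m → ZMod p) : ‖labelledPhase a b w q y r‖ ≤ Fintype.card ι := by
  refine (norm_sum_le _ _).trans ((Finset.sum_le_card_nsmul _ _ 1 fun l _ => ?_).trans ?_)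
  · split_ifs
    · rw [AddChar.norm_apply]
    · simp
  · rw [Finset.card_univ, nsmul_eq_mul, mul_one]

theorem norm_symPhase_le (a b w : ι → ZMod p) (q : ℕ) (y : ι → ZMod p)
    (r : PhaseIndex m → ZMod p) : ‖symPhase a b w q y r‖ ≤ 2 * Fintype.card ι := by
  refine (norm_add_le _ _).trans ?_
  rw [RCLike.norm_conj, two_mul]
  exact add_le_add (norm_labelledPhase_le _ _ _ _ _ _) (norm_labelledPhase_le _ _ _ _ _ _)

theorem symPhase_zero [DecidableEq ι] {a b : ι → ZMod p}
    (hmin : ∀ i j, i ≠ j → a i * b j - a j * b i ≠ 0) {i k : ι} (hik : i ≠ k)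
    (w : ι → ZMod p) (q : ℕ) (y : ι → ZMod p) :
    symPhase a b w q y (0 : PhaseIndex m → ZMod p) = 0 := by
  have h : labelledPhase a b w q y (0 : PhaseIndex m → ZMod p) = 0 := by
    refine Finset.sum_eq_zero fun l _ => if_neg fun hl => ?_
    obtain ⟨h1, h2⟩ := hasLabel_iff.mp hl
    obtain ⟨j, hj⟩ : ∃ j, l ≠ j := by
      by_cases h : l = i
      · exact ⟨k, h ▸ hik⟩
      · exact ⟨i, h⟩
    refine hmin l j hj ?_
    rw [← h1, ← h2]
    simp
  rw [symPhase, neg_zero, h, map_zero, add_zero]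

/-- The phase is linear in the second block, so summing over that block gives `p ^ m` times the
indicator of `w l * Y k ^ q = -x₂ k` for all `k`, which has at most `q ^ m` solutions `Y`. -/
theorem norm_trigSum_labelledPhase_le (a b : ι → ZMod p) {w : ι → ZMod p} (hw : ∀ l, w l ≠ 0)
    {q : ℕ} (hq : 0 < q) (y : ι → ZMod p) (x : PhaseIndex m → ZMod p) :
    ‖trigSum (labelledPhase a b w q y) x‖ ≤ Fintype.card ι * ((p : ℝ) ^ m * (q : ℝ) ^ m) := by
  have h1 : trigSum (labelledPhase a b w q y) x = ∑ l, ∑ r : PhaseIndex m → ZMod p,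
      if HasLabel a b l r then
        ZMod.stdAddChar (y l + w l * phasePoly q r + r ⬝ᵥ x) else 0 := by
    rw [trigSum, Finset.sum_comm]
    refine Finset.sum_congr rfl fun r _ => ?_
    rw [labelledPhase, Finset.sum_mul]
    refine Finset.sum_congr rfl fun l _ => ?_
    rw [ite_mul, zero_mul, AddChar.map_add_eq_mul _ (y l + _)]
  have h2 : ∀ l, ‖∑ r : PhaseIndex m → ZMod p, if HasLabel a b l r then
      (ZMod.stdAddChar (y l + w l * phasePoly q r + r ⬝ᵥ x) : ℂ) else 0‖ ≤
        (p : ℝ) ^ m * (q : ℝ) ^ m := by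
    intro l
    set ρ₀ : Fin 2 → ZMod p := ![a l, b l] with hρ₀
    set x₁ : Fin m → ZMod p := fun k => x (Sum.inr (Sum.inl k)) with hx₁
    set x₂ : Fin m → ZMod p := fun k => x (Sum.inr (Sum.inr k)) with hx₂
    have h3 : ∀ (ρ : Fin 2 → ZMod p) (Y Z : Fin m → ZMod p),
        (if HasLabel a b l (Sum.elim ρ (Sum.elim Y Z)) then (ZMod.stdAddChar (y l +
          w l * phasePoly q (Sum.elim ρ (Sum.elim Y Z)) + Sum.elim ρ (Sum.elim Y Z) ⬝ᵥ x) : ℂ)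
            else 0) =
        if ρ = ρ₀ then ZMod.stdAddChar (y l + ρ ⬝ᵥ (fun i => x (Sum.inl i)) + Y ⬝ᵥ x₁) *
          ZMod.stdAddChar ((fun k => w l * Y k ^ q + x₂ k) ⬝ᵥ Z) else 0 := by
      intro ρ Y Z
      refine if_congr Iff.rfl ?_ rfl
      rw [← AddChar.map_add_eq_mul]
      congr 1
      simp only [phasePoly, dotProduct, Fintype.sum_sum_type, Sum.elim_inl, Sum.elim_inr,
        Finset.mul_sum, add_mul, Finset.sum_add_distrib, hx₁, hx₂]
      simp only [mul_comm (x _), mul_assoc]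
      ring
    rw [sum_phaseIndex]
    simp only [h3]
    rw [Finset.sum_eq_single ρ₀ (fun ρ _ hρ => by simp [hρ])
      (fun h => absurd (Finset.mem_univ _) h)]
    simp only [if_true, ← Finset.mul_sum, sum_stdAddChar_dotProduct, Fintype.card_fin]
    refine (norm_sum_le _ _).trans ?_
    have h4 : ∀ Y : Fin m → ZMod p, ‖(ZMod.stdAddChar (y l + ρ₀ ⬝ᵥ (fun i => x (Sum.inl i)) +
        Y ⬝ᵥ x₁) : ℂ) * if (fun k => w l * Y k ^ q + x₂ k) = 0 then (p : ℂ) ^ m else 0‖ =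
        if ∀ k, w l * Y k ^ q + x₂ k = 0 then (p : ℝ) ^ m else 0 := by
      intro Y
      rw [norm_mul, AddChar.norm_apply, one_mul, apply_ite norm, norm_zero, norm_pow,
        Complex.norm_natCast]
      exact if_congr funext_iff rfl rfl
    rw [Finset.sum_congr rfl fun Y _ => h4 Y, ← Finset.sum_filter, Finset.sum_const,
      nsmul_eq_mul, mul_comm]
    refine mul_le_mul_of_nonneg_left ?_ (by positivity)
    exact_mod_cast card_pow_mul_add_eq_zero_le hq (hw l) x₂
  rw [h1]
  refine (norm_sum_le _ _).trans ((Finset.sum_le_card_nsmul _ _ _ fun l _ => h2 l).trans ?_)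
  rw [Finset.card_univ, nsmul_eq_mul]

theorem norm_trigSum_symPhase_le (a b : ι → ZMod p) {w : ι → ZMod p} (hw : ∀ l, w l ≠ 0)
    {q : ℕ} (hq : 0 < q) (y : ι → ZMod p) (x : PhaseIndex m → ZMod p) :
    ‖trigSum (symPhase a b w q y) x‖ ≤
      2 * (Fintype.card ι * ((p : ℝ) ^ m * (q : ℝ) ^ m)) := by
  have h : trigSum (symPhase a b w q y) x =
      trigSum (labelledPhase a b w q y) x + conj (trigSum (labelledPhase a b w q y) x) := by
    simp only [trigSum, symPhase, add_mul, Finset.sum_add_distrib, map_sum, map_mul]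
    congr 1
    refine Fintype.sum_equiv (Equiv.neg _) _ _ fun r => ?_
    rw [Equiv.neg_apply, neg_dotProduct, AddChar.map_neg_eq_conj, Complex.conj_conj]
  rw [h, two_mul]
  refine (norm_add_le _ _).trans ?_
  rw [RCLike.norm_conj]
  exact add_le_add (norm_trigSum_labelledPhase_le a b hw hq y x)
    (norm_trigSum_labelledPhase_le a b hw hq y x)

theorem symPhase_eq_sum (a b w : ι → ZMod p) (q : ℕ) (y : ι → ZMod p)
    (r : PhaseIndex m → ZMod p) :
    symPhase a b w q y r = ∑ ls : ι × Bool,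
      if HasLabel a b ls.1 ((boolSign ls.2 : ZMod p) • r) then
        ZMod.stdAddChar (boolSign ls.2 * (y ls.1 + w ls.1 *
          phasePoly q ((boolSign ls.2 : ZMod p) • r))) else 0 := by
  rw [Fintype.sum_prod_type]
  simp only [Fintype.sum_bool, Finset.sum_add_distrib, boolSign, if_true, Bool.false_eq_true,
    if_false, one_smul, one_mul, neg_smul, neg_one_mul]
  rw [symPhase, labelledPhase, labelledPhase, map_sum]
  congr 1
  refine Finset.sum_congr rfl fun l _ => ?_
  rw [apply_ite conj, map_zero, AddChar.map_neg_eq_conj]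

/-- The product of the phases over a family of points, averaged against the character
`y ↦ e (-∑ y l)`. -/
theorem sum_mul_prod_symPhase [DecidableEq ι] (a b w : ι → ZMod p) (q : ℕ)
    (z : ι → PhaseIndex m → ZMod p) :
    ∑ y : ι → ZMod p, ZMod.stdAddChar (-∑ l, y l) * ∏ j, symPhase a b w q y (z j) =
      ∑ τ : ι → ι × Bool, if (∀ j, HasLabel a b (τ j).1 ((boolSign (τ j).2 : ZMod p) • z j)) ∧
          ∀ l, (∑ j, if (τ j).1 = l then (boolSign (τ j).2 : ZMod p) else 0) = 1 then
        (p : ℂ) ^ Fintype.card ι * ZMod.stdAddChar (∑ j, boolSign (τ j).2 * (w (τ j).1 *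
          phasePoly q ((boolSign (τ j).2 : ZMod p) • z j))) else 0 := by
  have h1 : ∀ y : ι → ZMod p, (ZMod.stdAddChar (-∑ l, y l) : ℂ) *
      ∏ j, symPhase a b w q y (z j) = ∑ τ : ι → ι × Bool,
        if ∀ j, HasLabel a b (τ j).1 ((boolSign (τ j).2 : ZMod p) • z j) then
          ZMod.stdAddChar (∑ j, boolSign (τ j).2 * (w (τ j).1 *
            phasePoly q ((boolSign (τ j).2 : ZMod p) • z j))) *
          ZMod.stdAddChar ((fun l => (∑ j, if (τ j).1 = l then (boolSign (τ j).2 : ZMod p)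
            else 0) - 1) ⬝ᵥ y) else 0 := by
    intro y
    simp only [symPhase_eq_sum]
    rw [Finset.prod_univ_sum, Fintype.piFinset_univ, Finset.mul_sum]
    refine Finset.sum_congr rfl fun τ _ => ?_
    by_cases hc : ∀ j, HasLabel a b (τ j).1 ((boolSign (τ j).2 : ZMod p) • z j)
    swap
    · obtain ⟨j, hj⟩ := not_forall.mp hc
      rw [if_neg hc, Finset.prod_eq_zero (Finset.mem_univ j) (if_neg hj), mul_zero]
    rw [if_pos hc, Finset.prod_congr rfl fun j _ => if_pos (hc j), ← stdAddChar_sum, ← AddChar.map_add_eq_mul, ← AddChar.map_add_eq_mul]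
    congr 1
    have h2 : (fun l => (∑ j, if (τ j).1 = l then (boolSign (τ j).2 : ZMod p) else 0) - 1) ⬝ᵥ y =
        ∑ j, boolSign (τ j).2 * y (τ j).1 - ∑ l, y l := by
      simp only [dotProduct, sub_mul, one_mul, Finset.sum_sub_distrib, Finset.sum_mul, ite_mul,
        zero_mul]
      rw [Finset.sum_comm]
      simp
    rw [h2]
    simp only [mul_add, Finset.sum_add_distrib]
    ring
  rw [Finset.sum_congr rfl fun y _ => h1 y, Finset.sum_comm]
  refine Finset.sum_congr rfl fun τ _ => ?_
  by_cases hτ : ∀ j, HasLabel a b (τ j).1 ((boolSign (τ j).2 : ZMod p) • z j)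
  · simp only [if_pos hτ, ← Finset.mul_sum, sum_stdAddChar_dotProduct]
    rw [mul_ite, mul_zero, mul_comm]
    refine if_congr ?_ rfl rfl
    rw [funext_iff]
    simp only [Pi.zero_apply, sub_eq_zero]
    exact ⟨fun h => ⟨hτ, h⟩, fun h => h.2⟩
  · rw [if_neg fun h => hτ h.1]
    simp [hτ]

/-- Every label must occur since `0 ≠ 1`, so each occurs exactly once; its sign is then `1`, as `-1
≠ 1` for odd `p`. -/
theorem bijective_and_sign_of_sum_eq_one [DecidableEq ι] (hp : p ≠ 2) {τ : ι → ι × Bool}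
    (h : ∀ l, (∑ j, if (τ j).1 = l then (boolSign (τ j).2 : ZMod p) else 0) = 1) :
    Function.Bijective (fun j => (τ j).1) ∧ ∀ j, (τ j).2 = true := by
  have hsurj : Function.Surjective fun j => (τ j).1 := by
    intro l
    by_contra hl
    have h0 := h l
    rw [Finset.sum_eq_zero fun j _ => if_neg fun hj => hl ⟨j, hj⟩] at h0
    exact zero_ne_one h0
  have hinj := Finite.injective_iff_surjective.mpr hsurj
  refine ⟨⟨hinj, hsurj⟩, fun j => ?_⟩
  have hj := h (τ j).1
  rw [Finset.sum_eq_single j (fun i _ hij => if_neg fun he => hij (hinj he))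
    (fun hn => absurd (Finset.mem_univ _) hn), if_pos rfl] at hj
  by_contra hf
  rw [Bool.not_eq_true] at hf
  have : Fact (2 < p) := ⟨lt_of_le_of_ne (Fact.out : p.Prime).two_le hp.symm⟩
  rw [hf, boolSign, if_neg Bool.false_ne_true] at hj
  exact ZMod.neg_one_ne_one hj

/-- The labels may be permuted, but then the label coordinates of `z` form a change of basis
permuting the points. It rescales all weights equally, and interpolation in degree `q + 1 = t - 2`
still applies. -/
theorem sum_weight_mul_phasePoly_eq_zero [DecidableEq ι] {a b : ι → ZMod p}
    (hmin : ∀ i j, i ≠ j → a i * b j - a j * b i ≠ 0) {q : ℕ} (hq : Fintype.card ι = q + 3)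
    {σ : ι → ι} (hσ : Function.Bijective σ)
    {z : (PhaseIndex m → ZMod p) × (PhaseIndex m → ZMod p)}
    (hz : ∀ j, HasLabel a b (σ j) (a j • z.1 + b j • z.2)) :
    ∑ j, nodalWeight a b (σ j) * phasePoly q (a j • z.1 + b j • z.2) = 0 := by
  have h1 := fun j => (hasLabel_iff.mp (hz j)).1
  have h2 := fun j => (hasLabel_iff.mp (hz j)).2
  have h3 := nodalWeight_perm hσ h1 h2
  simp only [h3, phasePoly, Finset.mul_sum]
  rw [Finset.sum_comm]
  refine Finset.sum_eq_zero fun k _ => ?_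
  have h4 := sum_nodalWeight_mul_eq_zero hmin hq (z.1 (Sum.inr (Sum.inl k)))
    (z.2 (Sum.inr (Sum.inl k))) (z.1 (Sum.inr (Sum.inr k))) (z.2 (Sum.inr (Sum.inr k)))
  simp only [mul_assoc, ← Finset.mul_sum]
  exact mul_eq_zero_of_right _ h4

/-- All terms surviving the average over `y` have phase `1`, so nothing cancels and a lower bound
only needs a count of some of them. -/
theorem le_norm_sum_mul_sum_prod_symPhase [DecidableEq ι] (hp : p ≠ 2) {a b : ι → ZMod p}
    (hmin : ∀ i j, i ≠ j → a i * b j - a j * b i ≠ 0) {q : ℕ} (hq : Fintype.card ι = q + 3) :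
    (p : ℝ) ^ Fintype.card ι * (p : ℝ) ^ (4 * m) ≤
      ‖∑ y : ι → ZMod p, ZMod.stdAddChar (-∑ l, y l) *
        ∑ z : (PhaseIndex m → ZMod p) × (PhaseIndex m → ZMod p),
          ∏ j, symPhase a b (nodalWeight a b) q y (a j • z.1 + b j • z.2)‖ := by
  classical
  let good (z : (PhaseIndex m → ZMod p) × (PhaseIndex m → ZMod p)) (τ : ι → ι × Bool) : Prop :=
    (∀ j, HasLabel a b (τ j).1 ((boolSign (τ j).2 : ZMod p) • (a j • z.1 + b j • z.2))) ∧
      ∀ l, (∑ j, if (τ j).1 = l then (boolSign (τ j).2 : ZMod p) else 0) = 1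
  have h1 : ∑ y : ι → ZMod p, ZMod.stdAddChar (-∑ l, y l) *
        ∑ z : (PhaseIndex m → ZMod p) × (PhaseIndex m → ZMod p),
          ∏ j, symPhase a b (nodalWeight a b) q y (a j • z.1 + b j • z.2) =
      ((∑ z, ∑ τ, if good z τ then (p : ℝ) ^ Fintype.card ι else 0 : ℝ) : ℂ) := by
    simp only [Finset.mul_sum]
    rw [Finset.sum_comm, Complex.ofReal_sum]
    refine Finset.sum_congr rfl fun z _ => ?_
    rw [sum_mul_prod_symPhase, Complex.ofReal_sum]
    refine Finset.sum_congr rfl fun τ _ => ?_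
    rw [apply_ite Complex.ofReal, Complex.ofReal_zero, Complex.ofReal_pow, Complex.ofReal_natCast]
    by_cases hg : good z τ
    · rw [if_pos hg, if_pos hg]
      obtain ⟨hbij, hsign⟩ := bijective_and_sign_of_sum_eq_one hp hg.2
      have hs : ∀ j, (boolSign (τ j).2 : ZMod p) = 1 := fun j => by rw [hsign j]; rfl
      have hl := hg.1
      simp only [hs, one_smul] at hl
      simp only [hs, one_smul, one_mul]
      rw [sum_weight_mul_phasePoly_eq_zero hmin hq hbij hl, AddChar.map_zero_eq_one, mul_one]
    · rw [if_neg hg, if_neg hg]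
  have hnn : ∀ z τ, 0 ≤ if good z τ then (p : ℝ) ^ Fintype.card ι else 0 := fun z τ => by
    split_ifs <;> positivity
  rw [h1, Complex.norm_real, Real.norm_of_nonneg
    (Finset.sum_nonneg fun z _ => Finset.sum_nonneg fun τ _ => hnn z τ)]
  -- With label coordinates `(1, 0)` and `(0, 1)` in `z.1` and `z.2`, the `j`-th point carries the
  -- label `j`. The other coordinates are free, giving `p ^ (4 * m)` pairs.
  let E : ((Fin m ⊕ Fin m → ZMod p) × (Fin m ⊕ Fin m → ZMod p)) →
      (PhaseIndex m → ZMod p) × (PhaseIndex m → ZMod p) :=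
    fun s => (Sum.elim ![1, 0] s.1, Sum.elim ![0, 1] s.2)
  have hE : Function.Injective E := by
    intro s s' h
    have h1 := congrArg Prod.fst h
    have h2 := congrArg Prod.snd h
    exact Prod.ext (funext fun k => congrFun h1 (Sum.inr k)) (funext fun k => congrFun h2 (Sum.inr k))
  have hgood : ∀ s, good (E s) (fun j => (j, true)) := by
    intro s
    refine ⟨fun j => hasLabel_iff.mpr ?_, fun l => ?_⟩
    · simp [E, boolSign]
    · simp [boolSign]
  have hcard : Fintype.card ((Fin m ⊕ Fin m → ZMod p) × (Fin m ⊕ Fin m → ZMod p)) =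
      p ^ (4 * m) := by
    rw [Fintype.card_prod, Fintype.card_fun, ZMod.card, Fintype.card_sum, Fintype.card_fin,
      ← pow_add]
    congr 1
    ring
  calc (p : ℝ) ^ Fintype.card ι * (p : ℝ) ^ (4 * m)
      = ∑ z ∈ Finset.univ.map ⟨E, hE⟩, (p : ℝ) ^ Fintype.card ι := by
        rw [Finset.sum_const, Finset.card_map, Finset.card_univ, hcard, nsmul_eq_mul, mul_comm,
          Nat.cast_pow]
    _ ≤ ∑ z ∈ Finset.univ.map ⟨E, hE⟩, ∑ τ, if good z τ then (p : ℝ) ^ Fintype.card ι else 0 := by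
        refine Finset.sum_le_sum fun z hz => ?_
        obtain ⟨s, _, rfl⟩ := Finset.mem_map.mp hz
        refine le_trans (le_of_eq ?_) (Finset.single_le_sum (fun τ _ => hnn _ τ)
          (Finset.mem_univ (fun j => (j, true))))
        exact (if_pos (hgood s)).symm
    _ ≤ _ := Finset.sum_le_sum_of_subset_of_nonneg (Finset.subset_univ _)
        fun z _ _ => Finset.sum_nonneg fun τ _ => hnn z τ

end Phase

/-! ### The case of odd `t`. -/

section Odd

open ComplexConjugate

variable [Fact p.Prime] [Fintype ι] [DecidableEq ι]

theorem not_isSidorenko_of_odd {Ψ : LinearSystem p D ι} {a b : ι → ZMod p}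
    (hrel : ∀ w, w ∈ Ψ.relations ↔ ∃ α β, w = fun j => a j * α + b j * β)
    (hmin : ∀ i j, i ≠ j → a i * b j - a j * b i ≠ 0) {i k : ι} (hik : i ≠ k)
    (hodd : Odd (Fintype.card ι)) {q : ℕ} (hq0 : 0 < q) (hq : Fintype.card ι = q + 3) :
    ¬ Ψ.IsSidorenko := by
  intro hΨ
  have hqp : q + 2 ≤ p := by
    have := card_le_card_field_add_one hmin hik
    rw [ZMod.card] at this
    omega
  have hp : p ≠ 2 := by omega
  have hp0 : (0 : ℝ) < p := Nat.cast_pos.mpr (Fact.out : p.Prime).pos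
  have hqR : (0 : ℝ) < q := Nat.cast_pos.mpr hq0
  set t := Fintype.card ι with ht
  have ht0 : (0 : ℝ) < t := Nat.cast_pos.mpr (by omega)
  have hratio : 1 < (p : ℝ) / q := by
    rw [one_lt_div hqR]
    exact_mod_cast (by omega : q < p)
  -- As `q < p`, the gain `(p / q) ^ m` eventually beats all factors independent of `m`.
  obtain ⟨m, hm⟩ := pow_unbounded_of_one_lt ((t : ℝ) * (2 * t) ^ t * p ^ 2) hratio
  -- The reciprocal of the sup bound for `trigSum (symPhase ..)`, so that the rescaled function is
  -- bounded by `1`.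
  set ε : ℝ := 1 / (2 * (t * ((p : ℝ) ^ m * (q : ℝ) ^ m))) with hε
  have hε0 : 0 < ε := by positivity
  set N : ℝ := (Fintype.card (PhaseIndex m → ZMod p) : ℝ) with hN
  have hNp : N = (p : ℝ) ^ (2 + 2 * m) := by
    rw [hN, Fintype.card_fun, ZMod.card, Fintype.card_sum, Fintype.card_sum, Fintype.card_fin,
      Fintype.card_fin, Nat.cast_pow, two_mul]
  set E : ℝ := t * (N * (ε * (2 * t)) ^ (t - 1)) with hE
  set g : (ι → ZMod p) → (PhaseIndex m → ZMod p) → ℂ := symPhase a b (nodalWeight a b) q with hg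
  set R : (ι → ZMod p) → ℂ := fun y => ∑ z : (PhaseIndex m → ZMod p) × (PhaseIndex m → ZMod p),
    ∏ j, g y (a j • z.1 + b j • z.2) with hR
  have hbound : ∀ y, ∀ c : ℝ, |c| = ε → -E ≤ c ^ t * (R y).re := by
    intro y c hc
    have h := hΨ.neg_le_re_sum_prod hrel hmin hik (H := fun r => (c : ℂ) * g y r)
      (fun r => by rw [hg, symPhase_neg, map_mul, Complex.conj_ofReal])
      (by rw [hg, symPhase_zero hmin hik, mul_zero]) (fun x => by
        have h1 : trigSum (fun r => (c : ℂ) * g y r) x = c * trigSum (g y) x := by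
          simp only [trigSum, Finset.mul_sum, mul_assoc]
        rw [h1, norm_mul, Complex.norm_real, Real.norm_eq_abs, hc]
        refine (mul_le_mul_of_nonneg_left (norm_trigSum_symPhase_le a b
          (nodalWeight_ne_zero hmin) hq0 y x) hε0.le).trans ?_
        rw [← ht, hε, one_div, inv_mul_cancel₀ (by positivity)])
      (ε := ε * (2 * t)) (fun r => by
        rw [norm_mul, Complex.norm_real, Real.norm_eq_abs, hc]
        exact mul_le_mul_of_nonneg_left (norm_symPhase_le _ _ _ _ _ _) hε0.le)
    refine h.trans (le_of_eq ?_)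
    rw [← Complex.re_ofReal_mul, hR, Complex.ofReal_pow]
    simp only [Finset.prod_mul_distrib, Finset.prod_const, Finset.card_univ, Finset.mul_sum, ht]
  have hreal : ∀ y, conj (R y) = R y := by
    intro y
    simp only [hR, map_sum, map_prod]
    refine Fintype.sum_equiv (Equiv.neg _) _ _ fun z => Finset.prod_congr rfl fun j _ => ?_
    rw [hg, ← symPhase_neg, Equiv.neg_apply, Prod.fst_neg, Prod.snd_neg, smul_neg, smul_neg,
      neg_add]
  -- The bound for `c = ε` and `c = -ε`, with `t` odd, controls the real number `R y` from both
  -- sides.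
  have hnorm : ∀ y, ε ^ t * ‖R y‖ ≤ E := by
    intro y
    have h1 := hbound y ε (abs_of_pos hε0)
    have h2 := hbound y (-ε) (by rw [abs_neg, abs_of_pos hε0])
    rw [hodd.neg_pow] at h2
    rw [← Complex.conj_eq_iff_re.mp (hreal y), Complex.norm_real, Real.norm_eq_abs,
      ← abs_of_pos (pow_pos hε0 t), ← abs_mul, abs_le]
    constructor <;> linarith
  have hlow := le_norm_sum_mul_sum_prod_symPhase (m := m) hp hmin hq
  have hup : ‖∑ y : ι → ZMod p, (ZMod.stdAddChar (-∑ l, y l) : ℂ) * R y‖ ≤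
      (p : ℝ) ^ t * (E / ε ^ t) := by
    refine (norm_sum_le _ _).trans
      ((Finset.sum_le_card_nsmul _ _ (E / ε ^ t) fun y _ => ?_).trans ?_)
    · rw [norm_mul, AddChar.norm_apply, one_mul, le_div_iff₀ (by positivity), mul_comm]
      exact hnorm y
    · rw [Finset.card_univ, Fintype.card_fun, ZMod.card, nsmul_eq_mul, Nat.cast_pow]
  have hle : (p : ℝ) ^ (4 * m) ≤ E / ε ^ t :=
    le_of_mul_le_mul_left (hlow.trans hup) (by positivity)
  rw [le_div_iff₀ (by positivity)] at hle
  obtain ⟨n, hn⟩ : ∃ n, t = n + 1 := ⟨q + 2, by omega⟩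
  have hle2 : (p : ℝ) ^ (4 * m) * ε ≤ t * (p : ℝ) ^ (2 + 2 * m) * (2 * t) ^ n := by
    rw [hE, hNp, hn, Nat.add_sub_cancel, mul_pow, ← hn] at hle
    refine le_of_mul_le_mul_left (a := ε ^ n) ?_ (by positivity)
    calc ε ^ n * ((p : ℝ) ^ (4 * m) * ε) = (p : ℝ) ^ (4 * m) * ε ^ t := by
          rw [show ε ^ t = ε ^ n * ε by rw [hn, pow_succ]]; ring
      _ ≤ _ := hle
      _ = _ := by ring
  -- What remains is `p ^ m ≤ t * (2 * t) ^ t * p ^ 2 * q ^ m` up to a factor `p ^ (3 * m)`,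
  -- contrary to the choice of `m`.
  rw [hε, mul_one_div, div_le_iff₀ (by positivity)] at hle2
  have hpow : (2 * (t : ℝ)) ^ t = (2 * t) ^ n * (2 * t) := by
    rw [show (2 * (t : ℝ)) ^ t = (2 * t) ^ (n + 1) by rw [← hn], pow_succ]
  rw [div_pow, lt_div_iff₀ (by positivity), hpow] at hm
  have hpm : (0 : ℝ) < (p : ℝ) ^ (3 * m) := by positivity
  have h3 := mul_lt_mul_of_pos_left hm hpm
  refine absurd hle2 (not_le.mpr ?_)
  calc _ = (p : ℝ) ^ (3 * m) * ((t : ℝ) * ((2 * t) ^ n * (2 * t)) * p ^ 2 * q ^ m) := by ring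
    _ < _ := h3
    _ = _ := by ring

end Odd

end LinearSystem

theorem corollary1p4 (p : ℕ) [Fact p.Prime] (D t : ℕ) (ht : 4 ≤ t)
    (Ψ : LinearSystem p D (Fin t)) (hcodim : Ψ.codim = 2) (hs : Ψ.s = t - 1) :
    ¬ Ψ.IsSidorenko := by
  by_cases hne : ∀ i, Ψ i ≠ 0
  · obtain ⟨a, b, hrel, hmin⟩ := LinearSystem.exists_relations_eq ht hcodim hs hne
    have hij : (⟨0, by omega⟩ : Fin t) ≠ ⟨1, by omega⟩ := by simp
    rcases Nat.even_or_odd t with heven | hodd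
    · exact LinearSystem.not_isSidorenko_of_even hrel hmin hij (by rwa [Fintype.card_fin])
    · exact LinearSystem.not_isSidorenko_of_odd hrel hmin hij (by rwa [Fintype.card_fin])
        (q := t - 3) (by omega) (by rw [Fintype.card_fin]; omega)
  · obtain ⟨i, hi⟩ := not_forall.mp hne
    exact LinearSystem.not_isSidorenko_of_eq_zero (not_not.mp hi)
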